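/- Theorem 1.4 (Audenaert–Kittaneh's conjecture). Let $\mathscr H$ be a complex separable Hilbert space. For a bounded linear operator $X$ on $\mathscr H$ and $p>0$ put $|X|=(X^*X)^{1/2}$ and $$\|X\|_p=\bigl(\operatorname{tr}|X|^p\bigr)^{1/p}\in[0,\infty],$$ where $\operatorname{tr}T=\sum_k\langle e_k,Te_k\rangle$ for a positive operator $T$ and any orthonormal basis $(e_k)$ of $\mathscr H$. Let $\mathbb B_p(\mathscr H)$ be the $p$-Schatten class, that is, the set of all compact $X$ with $\|X\|_p<\infty$. Let $p,q>0$ with $\frac1p+\frac1q=1$, and let $A_1,\dots,A_n\in\mathbb B_p(\mathscr H)$. If $1<p\le 2$, then $$\Bigl\|\sum_{i=1}^nA_i\Bigr\|_p^q+\sum_{1\le i<j\le n}\|A_i-A_j\|_p^q\le n\Bigl(\sum_{i=1}^n\|A_i\|_p^p\Bigr)^{q/p},$$ and if $p\ge 2$, then $$n\Bigl(\sum_{i=1}^n\|A_i\|_p^p\Bigr)^{q/p}\le\Bigl\|\sum_{i=1}^nA_i\Bigr\|_p^q+\sum_{1\le i<j\le n}\|A_i-A_j\|_p^q.$$ -/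

import Mathlib

open scoped ENNReal InnerProductSpace

/-- The diagonal sum of the operator `T` along the Hilbert basis `b`, as an element of `[0, ∞]`. For
positive `T` all the summands `⟪b i, T (b i)⟫` are real and nonnegative. -/
noncomputable def diagSum {H ι : Type*} [NormedAddCommGroup H] [InnerProductSpace ℂ H]
    (b : HilbertBasis ι ℂ H) (T : H →L[ℂ] H) : ℝ≥0∞ :=
  ∑' i, ENNReal.ofReal (⟪b i, T (b i)⟫_ℂ).re

/-- The trace, with values in `[0, ∞]`, of a positive operator: its diagonal sum along a Hilbert
basis. It does not depend on the basis, see `posTrace_eq_diagSum`. -/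
noncomputable def posTrace {H : Type*} [NormedAddCommGroup H] [InnerProductSpace ℂ H]
    [CompleteSpace H] (T : H →L[ℂ] H) : ℝ≥0∞ :=
  diagSum (exists_hilbertBasis ℂ H).choose_spec.choose T

theorem parseval_ennreal {H ι : Type*} [NormedAddCommGroup H] [InnerProductSpace ℂ H]
    (b : HilbertBasis ι ℂ H) (x : H) :
    ∑' i, ENNReal.ofReal (‖⟪b i, x⟫_ℂ‖ ^ 2) = ENNReal.ofReal (‖x‖ ^ 2) := by
  have h := (b.hasSum_inner_mul_inner x x).mapL Complex.reCLM
  have e : (fun i => Complex.reCLM (⟪x, b i⟫_ℂ * ⟪b i, x⟫_ℂ)) =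
      fun i => ‖⟪b i, x⟫_ℂ‖ ^ 2 := by
    funext i
    rw [← inner_conj_symm x (b i), ← Complex.normSq_eq_conj_mul_self, Complex.normSq_eq_norm_sq]
    simp only [Complex.reCLM_apply, Complex.ofReal_re]
  rw [e] at h
  have h2 : Complex.reCLM ⟪x, x⟫_ℂ = ‖x‖ ^ 2 := by
    rw [inner_self_eq_norm_sq_to_K]
    simp [← Complex.ofReal_pow]
  rw [h2] at h
  rw [← ENNReal.ofReal_tsum_of_nonneg (fun i => by positivity) h.summable, h.tsum_eq]

/-- The diagonal sum of a positive operator is the same for any two Hilbert bases. -/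
theorem diagSum_eq_diagSum {H ι κ : Type*} [NormedAddCommGroup H] [InnerProductSpace ℂ H]
    [CompleteSpace H] (b : HilbertBasis ι ℂ H) (c : HilbertBasis κ ℂ H) (T : H →L[ℂ] H)
    (hT : 0 ≤ T) : diagSum b T = diagSum c T := by
  obtain ⟨S, hS, hST⟩ : ∃ S : H →L[ℂ] H, IsSelfAdjoint S ∧ S * S = T :=
    ⟨CFC.sqrt T, (CFC.sqrt_nonneg T).isSelfAdjoint, CFC.sqrt_mul_sqrt_self T⟩
  have hsym : ∀ x y : H, ⟪S x, y⟫_ℂ = ⟪x, S y⟫_ℂ := fun x y =>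
    (ContinuousLinearMap.isSelfAdjoint_iff_isSymmetric.mp hS) x y
  have key : ∀ x : H, (⟪x, T x⟫_ℂ).re = ‖S x‖ ^ 2 := fun x => by
    rw [← hST, mul_apply_eq_comp, ← hsym, inner_self_eq_norm_sq_to_K]
    simp [← Complex.ofReal_pow]
  simp only [diagSum, key]
  calc ∑' i, ENNReal.ofReal (‖S (b i)‖ ^ 2)
      = ∑' i, ∑' j, ENNReal.ofReal (‖⟪c j, S (b i)⟫_ℂ‖ ^ 2) := by
        simp only [parseval_ennreal]
    _ = ∑' j, ∑' i, ENNReal.ofReal (‖⟪c j, S (b i)⟫_ℂ‖ ^ 2) := ENNReal.tsum_comm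
    _ = ∑' j, ∑' i, ENNReal.ofReal (‖⟪b i, S (c j)⟫_ℂ‖ ^ 2) := by
        simp only [fun i j => (norm_inner_symm (c j) (S (b i))).trans
          (congrArg norm (hsym (b i) (c j)))]
    _ = ∑' j, ENNReal.ofReal (‖S (c j)‖ ^ 2) := by
        simp only [parseval_ennreal]

theorem posTrace_eq_diagSum {H ι : Type*} [NormedAddCommGroup H] [InnerProductSpace ℂ H]
    [CompleteSpace H] (b : HilbertBasis ι ℂ H) (T : H →L[ℂ] H) (hT : 0 ≤ T) :
    posTrace T = diagSum b T :=
  diagSum_eq_diagSum _ b T hT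

/-- The Schatten norm `‖X‖_p = (tr |X|^p)^(1/p)` in `[0, ∞]`, for `p > 0`. Here `|X|` is the square
root of `X* X`, and `|X|^p` is given by the functional calculus. -/
noncomputable def schattenNorm {H : Type*} [NormedAddCommGroup H] [InnerProductSpace ℂ H]
    [CompleteSpace H] (p : ℝ) (X : H →L[ℂ] H) : ℝ≥0∞ :=
  posTrace (CFC.abs X ^ p) ^ (1 / p)

/-- The Schatten class of compact operators `X` with `‖X‖_p < ∞`. -/
def schattenClass (H : Type*) [NormedAddCommGroup H] [InnerProductSpace ℂ H]
    [CompleteSpace H] (p : ℝ) : Set (H →L[ℂ] H) :=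
  {X | IsCompactOperator X ∧ schattenNorm p X < ∞}

open scoped NNReal

/- Only two properties of the matrix `T` that sends `(A_i)` to the sum and the differences matter:
its entries are at most `1` in modulus, and `Tᴴ T = n`. Singular value decompositions of the `A_i`,
with values `s`, and of the `B_l = ∑ i, T l i • A_i`, with values `t`, turn the claim into one about
sequences: `t = K s` and `n s = K* t`, where `K = (T l i ⟪h, f⟫⟪e, g⟫)` is built from `T` and the
singular vectors. Bessel's inequality makes `K` a contraction `ℓ¹ → ℓ^∞(ℓ¹)`, while `Tᴴ T = n`
bounds it by `√n` from `ℓ²` to `ℓ²`. Complex interpolation bounds it by `n ^ (1 / q)` from `ℓ^p` to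
`ℓ^q(ℓ^p)` for `p ≤ 2`. Applied to `t = K s` this is the first inequality; the second is the dual
bound, with `p` and `q` exchanged, applied to `n s = K* t`. -/

/-- The power `x ^ z` of a nonnegative number as an entire function of `z`, with the value `0` at
`x = 0` for every `z`, including `z = 0`. It builds the analytic families of the interpolation. -/
noncomputable def analyticPow (x : ℝ≥0) (z : ℂ) : ℂ :=
  if x = 0 then 0 else (x : ℂ) ^ z

theorem differentiable_analyticPow (x : ℝ≥0) : Differentiable ℂ (analyticPow x) := by
  unfold analyticPow
  split_ifs with hx
  · fun_prop
  · exact differentiable_id.const_cpow (Or.inl (by exact_mod_cast hx))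

theorem nnnorm_analyticPow_le (x : ℝ≥0) (z : ℂ) : ‖analyticPow x z‖₊ ≤ x ^ z.re := by
  unfold analyticPow
  split_ifs with hx
  · simp
  · rw [← NNReal.coe_le_coe, coe_nnnorm, NNReal.coe_rpow,
      Complex.norm_cpow_eq_rpow_re_of_pos (by positivity)]

theorem nnnorm_analyticPow_le_one {x : ℝ≥0} (hx : x ≤ 1) {z : ℂ} (hz : 0 ≤ z.re) :
    ‖analyticPow x z‖₊ ≤ 1 :=
  (nnnorm_analyticPow_le x z).trans (NNReal.rpow_le_one hx hz)

theorem analyticPow_one (x : ℝ≥0) : analyticPow x 1 = x := by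
  unfold analyticPow
  split_ifs with hx <;> simp [hx]

theorem norm_le_rpow_of_norm_le_on_strip {F : ℂ → ℂ} (hF : Differentiable ℂ F) {B R : ℝ}
    (hB : ∀ z : ℂ, 0 ≤ z.re → z.re ≤ 1 → ‖F z‖ ≤ B) (h0 : ∀ z : ℂ, z.re = 0 → ‖F z‖ ≤ 1)
    (h1 : ∀ z : ℂ, z.re = 1 → ‖F z‖ ≤ R) {θ : ℝ} (hθ0 : 0 ≤ θ) (hθ1 : θ ≤ 1) :
    ‖F θ‖ ≤ R ^ θ := by
  have hbdd : BddAbove ((norm ∘ F) '' Complex.HadamardThreeLines.verticalClosedStrip 0 1) :=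
    ⟨B, by rintro _ ⟨z, hz, rfl⟩; exact hB z hz.1 hz.2⟩
  simpa using Complex.HadamardThreeLines.norm_le_interp_of_mem_verticalClosedStrip'
    (f := F) (z := θ) zero_lt_one ⟨by simpa using hθ0, by simpa using hθ1⟩
    hF.diffContOnCl hbdd h0 h1

section Kernel

variable {L α : Type*} [Fintype L] {κ : L → Type*}

/-- A kernel that defines an operator of norm at most `1` from `ℓ¹(α)` to `ℓ^∞(L; ℓ¹(κ l))` and of
norm at most `√N` from `ℓ²(α)` to `ℓ²(L; ℓ²(κ l))`. Both bounds are stated on finite subsets. -/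
structure IsInterpolationKernel (K : ∀ l, κ l → α → ℂ) (N : ℝ≥0) : Prop where
  sum_nnnorm_le_one : ∀ l (M : Finset (κ l)) a, ∑ m ∈ M, ‖K l m a‖₊ ≤ 1
  nnnorm_sum_sq_le : ∀ (M : ∀ l, Finset (κ l)) (s : Finset α) (c : ∀ l, κ l → ℂ) (d : α → ℂ),
    ‖∑ l, ∑ m ∈ M l, ∑ a ∈ s, c l m * K l m a * d a‖₊ ^ 2 ≤
      N * (∑ l, ∑ m ∈ M l, ‖c l m‖₊ ^ 2) * ∑ a ∈ s, ‖d a‖₊ ^ 2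

theorem le_one_of_sum_rpow_le_one {ι : Type*} {s : Finset ι} {x : ι → ℝ≥0} {p : ℝ} (hp : 0 < p)
    (h : ∑ i ∈ s, x i ^ p ≤ 1) {i : ι} (hi : i ∈ s) : x i ≤ 1 := by
  rw [← NNReal.rpow_le_rpow_iff hp, NNReal.one_rpow]
  exact (Finset.single_le_sum (f := fun i => x i ^ p) (fun _ _ => zero_le) hi).trans h

theorem sum_sq_analyticPow_le_one {ι : Type*} (s : Finset ι) {d : ι → ℝ≥0} {p : ℝ}
    (hd : ∑ a ∈ s, d a ^ p ≤ 1) {z : ℂ} (hz : z.re = p / 2) :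
    ∑ a ∈ s, ‖analyticPow (d a) z‖₊ ^ 2 ≤ 1 := by
  refine (Finset.sum_le_sum fun a _ => ?_).trans hd
  calc ‖analyticPow (d a) z‖₊ ^ 2 ≤ (d a ^ z.re) ^ 2 := by gcongr; exact nnnorm_analyticPow_le _ _
    _ = d a ^ p := by rw [hz, ← NNReal.rpow_two, ← NNReal.rpow_mul, div_mul_cancel₀ p two_ne_zero]

theorem le_two_iff_of_holderConjugate {p q : ℝ} (hpq : p.HolderConjugate q) : p ≤ 2 ↔ 2 ≤ q := by
  rw [hpq.conjugate_eq, le_div_iff₀ hpq.sub_one_pos]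
  constructor <;> intro h <;> linarith

theorem exists_eq_mul_normalized {ι : Type*} (s : Finset ι) (x : ι → ℝ≥0) {p : ℝ} (hp : 0 < p) :
    ∃ y : ι → ℝ≥0, ∑ i ∈ s, y i ^ p ≤ 1 ∧ ∀ i ∈ s, x i = (∑ j ∈ s, x j ^ p) ^ (1 / p) * y i := by
  rcases eq_or_ne (∑ j ∈ s, x j ^ p) 0 with h0 | h0
  · refine ⟨0, by simp [hp.ne'], fun i hi => ?_⟩
    have := (NNReal.rpow_eq_zero hp.ne').mp (Finset.sum_eq_zero_iff.mp h0 i hi)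
    simpa using this
  · have hS : (∑ j ∈ s, x j ^ p) ^ (1 / p) ≠ 0 := by simp [h0]
    refine ⟨fun i => x i / (∑ j ∈ s, x j ^ p) ^ (1 / p), ?_, fun i _ => (mul_div_cancel₀ _ hS).symm⟩
    simp only [NNReal.div_rpow, ← Finset.sum_div]
    rw [← NNReal.rpow_mul, one_div_mul_cancel hp.ne', NNReal.rpow_one, div_self h0]

namespace IsInterpolationKernel

variable {K : ∀ l, κ l → α → ℂ} {N : ℝ≥0}

theorem nnnorm_sum_le (hK : IsInterpolationKernel K N) (M : ∀ l, Finset (κ l)) (s : Finset α)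
    {c : ∀ l, κ l → ℂ} {d : α → ℂ} {x : L → ℝ≥0} {y : α → ℝ≥0} (hc : ∀ l, ∀ m ∈ M l, ‖c l m‖₊ ≤ x l)
    (hd : ∀ a ∈ s, ‖d a‖₊ ≤ y a) :
    ‖∑ l, ∑ m ∈ M l, ∑ a ∈ s, c l m * K l m a * d a‖₊ ≤ (∑ l, x l) * ∑ a ∈ s, y a := by
  calc ‖∑ l, ∑ m ∈ M l, ∑ a ∈ s, c l m * K l m a * d a‖₊
      ≤ ∑ l, ∑ m ∈ M l, ∑ a ∈ s, ‖c l m‖₊ * ‖K l m a‖₊ * ‖d a‖₊ := by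
        refine nnnorm_sum_le_of_le _ fun l _ => nnnorm_sum_le_of_le _ fun m _ =>
          nnnorm_sum_le_of_le _ fun a _ => ?_
        rw [nnnorm_mul, nnnorm_mul]
    _ ≤ ∑ l, ∑ m ∈ M l, ∑ a ∈ s, x l * ‖K l m a‖₊ * y a := by
        gcongr with l _ m hm a ha
        · exact hc l m hm
        · exact hd a ha
    _ = ∑ l, x l * ∑ a ∈ s, (∑ m ∈ M l, ‖K l m a‖₊) * y a := by
        refine Finset.sum_congr rfl fun l _ => ?_
        simp only [Finset.sum_comm (s := M l), Finset.mul_sum, Finset.sum_mul, mul_assoc]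
    _ ≤ ∑ l, x l * ∑ a ∈ s, 1 * y a := by
        gcongr with l _ a
        exact hK.sum_nnnorm_le_one l (M l) a
    _ = (∑ l, x l) * ∑ a ∈ s, y a := by simp only [one_mul, Finset.sum_mul]

theorem nnnorm_analyticFamily_le (hK : IsInterpolationKernel K N) {M : ∀ l, Finset (κ l)}
    {s : Finset α} {γ : L → ℝ≥0} {c : ∀ l, κ l → ℝ≥0} {d : α → ℝ≥0} (hc : ∀ l, ∀ m ∈ M l, c l m ≤ 1)
    (ζ : ℂ) {ω : ℂ} (hω : 0 ≤ ω.re) :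
    ‖∑ l, ∑ m ∈ M l, ∑ a ∈ s,
        analyticPow (γ l) ζ * analyticPow (c l m) ω * K l m a * analyticPow (d a) ζ‖₊ ≤
      (∑ l, γ l ^ ζ.re) * ∑ a ∈ s, d a ^ ζ.re := by
  refine hK.nnnorm_sum_le M s (fun l m hm => ?_) fun a _ => nnnorm_analyticPow_le _ _
  rw [nnnorm_mul, ← mul_one (γ l ^ ζ.re)]
  exact mul_le_mul' (nnnorm_analyticPow_le _ _) (nnnorm_analyticPow_le_one (hc l m hm) hω)

theorem nnnorm_analyticFamily_le_card (hK : IsInterpolationKernel K N) {M : ∀ l, Finset (κ l)}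
    {s : Finset α} {γ : L → ℝ≥0} {c : ∀ l, κ l → ℝ≥0} {d : α → ℝ≥0} (hγ : ∀ l, γ l ≤ 1)
    (hc : ∀ l, ∀ m ∈ M l, c l m ≤ 1) (hd : ∀ a ∈ s, d a ≤ 1) {ζ ω : ℂ} (hζ : 0 ≤ ζ.re)
    (hω : 0 ≤ ω.re) :
    ‖∑ l, ∑ m ∈ M l, ∑ a ∈ s,
        analyticPow (γ l) ζ * analyticPow (c l m) ω * K l m a * analyticPow (d a) ζ‖₊ ≤
      Fintype.card L * s.card := by
  calc _ ≤ (∑ l, γ l ^ ζ.re) * ∑ a ∈ s, d a ^ ζ.re := hK.nnnorm_analyticFamily_le hc ζ hω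
    _ ≤ (∑ _l : L, 1) * ∑ _a ∈ s, 1 := by
      gcongr with l _ a ha
      · exact NNReal.rpow_le_one (hγ l) hζ
      · exact NNReal.rpow_le_one (hd a ha) hζ
    _ = Fintype.card L * s.card := by simp

theorem nnnorm_analyticFamily_le_sqrt (hK : IsInterpolationKernel K N) {M : ∀ l, Finset (κ l)}
    {s : Finset α} {γ : L → ℝ≥0} {c : ∀ l, κ l → ℝ≥0} {d : α → ℝ≥0} {p q : ℝ}
    (hγ : ∑ l, γ l ^ p ≤ 1) (hc : ∀ l, ∑ m ∈ M l, c l m ^ q ≤ 1) (hd : ∑ a ∈ s, d a ^ p ≤ 1)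
    {ζ ω : ℂ} (hζ : ζ.re = p / 2) (hω : ω.re = q / 2) :
    ‖∑ l, ∑ m ∈ M l, ∑ a ∈ s,
        analyticPow (γ l) ζ * analyticPow (c l m) ω * K l m a * analyticPow (d a) ζ‖₊ ≤
      NNReal.sqrt N := by
  have hw : ∑ l, ∑ m ∈ M l, ‖analyticPow (γ l) ζ * analyticPow (c l m) ω‖₊ ^ 2 ≤ 1 := by
    refine (Finset.sum_le_sum fun l _ => ?_).trans (sum_sq_analyticPow_le_one _ hγ hζ)
    simp only [nnnorm_mul, mul_pow, ← Finset.mul_sum]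
    exact mul_le_of_le_one_right' (sum_sq_analyticPow_le_one _ (hc l) hω)
  rw [NNReal.le_sqrt_iff_sq_le]
  calc _ ≤ N * (∑ l, ∑ m ∈ M l, ‖analyticPow (γ l) ζ * analyticPow (c l m) ω‖₊ ^ 2) *
        ∑ a ∈ s, ‖analyticPow (d a) ζ‖₊ ^ 2 := hK.nnnorm_sum_sq_le M s _ _
    _ ≤ N * 1 * 1 := by gcongr; exact sum_sq_analyticPow_le_one _ hd hζ
    _ = N := by rw [mul_one, mul_one]

theorem norm_analyticFamily_le_rpow (hK : IsInterpolationKernel K N) {p q : ℝ} (hp : 0 < p)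
    (hq : 0 < q) {M : ∀ l, Finset (κ l)} {s : Finset α} {γ : L → ℝ≥0} {c : ∀ l, κ l → ℝ≥0}
    {d : α → ℝ≥0} (hγ : ∑ l, γ l ^ p ≤ 1) (hc : ∀ l, ∑ m ∈ M l, c l m ^ q ≤ 1)
    (hd : ∑ a ∈ s, d a ^ p ≤ 1) {θ : ℝ} (hθ0 : 0 ≤ θ) (hθ1 : θ ≤ 1) :
    ‖∑ l, ∑ m ∈ M l, ∑ a ∈ s, analyticPow (γ l) (p * (1 - θ / 2)) *
        analyticPow (c l m) (q / 2 * θ) * K l m a * analyticPow (d a) (p * (1 - θ / 2))‖ ≤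
      (NNReal.sqrt N : ℝ) ^ θ := by
  have hγ1 : ∀ l, γ l ≤ 1 := fun l => le_one_of_sum_rpow_le_one hp hγ (Finset.mem_univ l)
  have hc1 : ∀ l, ∀ m ∈ M l, c l m ≤ 1 := fun l m => le_one_of_sum_rpow_le_one hq (hc l)
  have hd1 : ∀ a ∈ s, d a ≤ 1 := fun a => le_one_of_sum_rpow_le_one hp hd
  let P : ℂ → ℂ := fun z => p * (1 - z / 2)
  let Q : ℂ → ℂ := fun z => q / 2 * z
  have hP : ∀ z, (P z).re = p * (1 - z.re / 2) := fun z => by simp [P]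
  have hQ : ∀ z, (Q z).re = q / 2 * z.re := fun z => by simp [Q]
  have hQ0 : ∀ z : ℂ, 0 ≤ z.re → 0 ≤ (Q z).re := fun z hz => by rw [hQ]; positivity
  let F : ℂ → ℂ := fun z => ∑ l, ∑ m ∈ M l, ∑ a ∈ s,
    analyticPow (γ l) (P z) * analyticPow (c l m) (Q z) * K l m a * analyticPow (d a) (P z)
  have hF : Differentiable ℂ F := by
    have := differentiable_analyticPow
    fun_prop
  have h_strip : ∀ z : ℂ, 0 ≤ z.re → z.re ≤ 1 → ‖F z‖ ≤ (Fintype.card L * s.card : ℝ≥0) :=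
    fun z hz0 hz1 => hK.nnnorm_analyticFamily_le_card hγ1 hc1 hd1
      (by rw [hP]; nlinarith) (hQ0 z hz0)
  have h_left : ∀ z : ℂ, z.re = 0 → ‖F z‖ ≤ 1 := by
    intro z hz
    have hPz : (P z).re = p := by simp [hP, hz]
    exact (hK.nnnorm_analyticFamily_le hc1 (P z) (hQ0 z hz.ge)).trans
      (hPz ▸ mul_le_one' hγ hd)
  have h_right : ∀ z : ℂ, z.re = 1 → ‖F z‖ ≤ NNReal.sqrt N := fun z hz =>
    hK.nnnorm_analyticFamily_le_sqrt hγ hc hd (by rw [hP, hz]; ring) (by rw [hQ, hz, mul_one])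
  exact norm_le_rpow_of_norm_le_on_strip hF h_strip h_left h_right hθ0 hθ1

theorem nnnorm_sum_le_of_normalized (hK : IsInterpolationKernel K N) {p q : ℝ}
    (hpq : p.HolderConjugate q) (hp2 : p ≤ 2) {M : ∀ l, Finset (κ l)} {s : Finset α} {γ : L → ℝ≥0}
    {c : ∀ l, κ l → ℝ≥0} {d : α → ℝ≥0} (hγ : ∑ l, γ l ^ p ≤ 1) (hc : ∀ l, ∑ m ∈ M l, c l m ^ q ≤ 1)
    (hd : ∑ a ∈ s, d a ^ p ≤ 1) :
    ‖∑ l, ∑ m ∈ M l, ∑ a ∈ s, (γ l : ℂ) * c l m * K l m a * d a‖₊ ≤ N ^ (1 / q) := by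
  have hq := hpq.symm.pos
  have hθ : 2 / q ≤ 1 := (div_le_one hq).mpr ((le_two_iff_of_holderConjugate hpq).mp hp2)
  have hP : (p : ℂ) * (1 - (2 / q : ℝ) / 2) = 1 := by
    have : p * (1 - 2 / q / 2) = 1 := by linear_combination -hpq.div_conj_eq_sub_one
    exact_mod_cast this
  have hQ : (q : ℂ) / 2 * (2 / q : ℝ) = 1 := by
    have : q / 2 * (2 / q) = 1 := by field_simp
    exact_mod_cast this
  have key := hK.norm_analyticFamily_le_rpow hpq.pos hq hγ hc hd (by positivity) hθ
  simp only [hP, hQ, analyticPow_one] at key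
  rwa [← NNReal.coe_rpow, NNReal.sqrt_eq_rpow, ← NNReal.rpow_mul,
    div_mul_div_cancel₀ two_ne_zero] at key

theorem nnnorm_sum_le_of_normalized_left (hK : IsInterpolationKernel K N) {p q : ℝ}
    (hpq : p.HolderConjugate q) (hp2 : p ≤ 2) {M : ∀ l, Finset (κ l)} {γ : L → ℝ≥0}
    {c : ∀ l, κ l → ℝ≥0} (hγ : ∑ l, γ l ^ p ≤ 1) (hc : ∀ l, ∑ m ∈ M l, c l m ^ q ≤ 1)
    (s : Finset α) (d : α → ℝ≥0) :
    ‖∑ l, ∑ m ∈ M l, ∑ a ∈ s, (γ l : ℂ) * c l m * K l m a * d a‖₊ ≤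
      N ^ (1 / q) * (∑ a ∈ s, d a ^ p) ^ (1 / p) := by
  obtain ⟨e, he, hde⟩ := exists_eq_mul_normalized s d hpq.pos
  set D := (∑ a ∈ s, d a ^ p) ^ (1 / p)
  calc ‖∑ l, ∑ m ∈ M l, ∑ a ∈ s, (γ l : ℂ) * c l m * K l m a * d a‖₊
      = ‖(D : ℂ) * ∑ l, ∑ m ∈ M l, ∑ a ∈ s, (γ l : ℂ) * c l m * K l m a * e a‖₊ := by
        simp only [Finset.mul_sum]
        refine congrArg nnnorm <| Finset.sum_congr rfl fun l _ => Finset.sum_congr rfl fun m _ =>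
          Finset.sum_congr rfl fun a ha => ?_
        rw [hde a ha]
        push_cast
        ring
    _ = D * ‖∑ l, ∑ m ∈ M l, ∑ a ∈ s, (γ l : ℂ) * c l m * K l m a * e a‖₊ := by
        rw [nnnorm_mul, Complex.nnnorm_real, NNReal.nnnorm_eq]
    _ ≤ D * N ^ (1 / q) := by
        gcongr
        exact hK.nnnorm_sum_le_of_normalized hpq hp2 hγ hc he
    _ = N ^ (1 / q) * D := mul_comm _ _

theorem nnnorm_sum_le_rpow (hK : IsInterpolationKernel K N) {p q : ℝ}
    (hpq : p.HolderConjugate q) (hp2 : p ≤ 2) (M : ∀ l, Finset (κ l)) (c : ∀ l, κ l → ℝ≥0)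
    (s : Finset α) (d : α → ℝ≥0) :
    ‖∑ l, ∑ m ∈ M l, ∑ a ∈ s, (c l m : ℂ) * K l m a * d a‖₊ ≤
      N ^ (1 / q) * (∑ l, (∑ m ∈ M l, c l m ^ q) ^ (p / q)) ^ (1 / p) *
        (∑ a ∈ s, d a ^ p) ^ (1 / p) := by
  choose b hb hcb using fun l => exists_eq_mul_normalized (M l) (c l) hpq.symm.pos
  obtain ⟨γ, hγ, hGγ⟩ := exists_eq_mul_normalized Finset.univ
    (fun l => (∑ m ∈ M l, c l m ^ q) ^ (1 / q)) hpq.pos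
  simp only [← NNReal.rpow_mul, one_div_mul_eq_div] at hGγ
  set G := (∑ l, (∑ m ∈ M l, c l m ^ q) ^ (p / q)) ^ (1 / p)
  calc ‖∑ l, ∑ m ∈ M l, ∑ a ∈ s, (c l m : ℂ) * K l m a * d a‖₊
      = ‖(G : ℂ) * ∑ l, ∑ m ∈ M l, ∑ a ∈ s, (γ l : ℂ) * b l m * K l m a * d a‖₊ := by
        simp only [Finset.mul_sum]
        refine congrArg nnnorm <| Finset.sum_congr rfl fun l _ => Finset.sum_congr rfl fun m hm =>
          Finset.sum_congr rfl fun a _ => ?_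
        rw [hcb l m hm, hGγ l (Finset.mem_univ l)]
        push_cast
        ring
    _ = G * ‖∑ l, ∑ m ∈ M l, ∑ a ∈ s, (γ l : ℂ) * b l m * K l m a * d a‖₊ := by
        rw [nnnorm_mul, Complex.nnnorm_real, NNReal.nnnorm_eq]
    _ ≤ G * (N ^ (1 / q) * (∑ a ∈ s, d a ^ p) ^ (1 / p)) := by
        gcongr
        exact hK.nnnorm_sum_le_of_normalized_left hpq hp2 hγ hb s d
    _ = _ := by rw [← mul_assoc, mul_comm G]

theorem sum_mul_le_of_hasSum (hK : IsInterpolationKernel K N) {p q : ℝ}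
    (hpq : p.HolderConjugate q) (hp2 : p ≤ 2) {s : α → ℝ≥0} {t : ∀ l, κ l → ℝ≥0}
    (hst : ∀ l m, HasSum (fun a => K l m a * s a) (t l m : ℂ))
    {M : ∀ l, Finset (κ l)} {γ : L → ℝ≥0} {c : ∀ l, κ l → ℝ≥0}
    (hγ : ∑ l, γ l ^ p ≤ 1) (hc : ∀ l, ∑ m ∈ M l, c l m ^ q ≤ 1) :
    ((∑ l, ∑ m ∈ M l, γ l * c l m * t l m : ℝ≥0) : ℝ≥0∞) ≤
      N ^ (1 / q) * (∑' a, (s a : ℝ≥0∞) ^ p) ^ (1 / p) := by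
  have hlim : HasSum (fun a => ∑ l, ∑ m ∈ M l, (γ l : ℂ) * c l m * K l m a * s a)
      ((∑ l, ∑ m ∈ M l, γ l * c l m * t l m : ℝ≥0) : ℂ) := by
    push_cast
    refine hasSum_sum fun l _ => hasSum_sum fun m _ => ?_
    simpa only [mul_assoc] using (hst l m).mul_left ((γ l : ℂ) * c l m)
  calc ((∑ l, ∑ m ∈ M l, γ l * c l m * t l m : ℝ≥0) : ℝ≥0∞)
      = ‖((∑ l, ∑ m ∈ M l, γ l * c l m * t l m : ℝ≥0) : ℂ)‖ₑ := by
        rw [enorm_eq_nnnorm, Complex.nnnorm_real, NNReal.nnnorm_eq]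
    _ ≤ N ^ (1 / q) * (∑' a, (s a : ℝ≥0∞) ^ p) ^ (1 / p) := by
        refine le_of_tendsto' hlim.enorm fun S => ?_
        calc ‖∑ a ∈ S, ∑ l, ∑ m ∈ M l, (γ l : ℂ) * c l m * K l m a * s a‖ₑ
            = ‖∑ l, ∑ m ∈ M l, ∑ a ∈ S, (γ l : ℂ) * c l m * K l m a * s a‖ₑ := by
              simp only [Finset.sum_comm (s := S)]
          _ ≤ ((N ^ (1 / q) * (∑ a ∈ S, s a ^ p) ^ (1 / p) : ℝ≥0) : ℝ≥0∞) := by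
              exact_mod_cast hK.nnnorm_sum_le_of_normalized_left hpq hp2 hγ hc S s
          _ = N ^ (1 / q) * (∑ a ∈ S, (s a : ℝ≥0∞) ^ p) ^ (1 / p) := by
              simp only [ENNReal.coe_mul, ENNReal.ofNNReal_finsetSum, ENNReal.coe_rpow_of_nonneg,
                hpq.nonneg, hpq.one_div_nonneg, hpq.symm.one_div_nonneg]
          _ ≤ N ^ (1 / q) * (∑' a, (s a : ℝ≥0∞) ^ p) ^ (1 / p) := by
              have := hpq.one_div_nonneg
              gcongr
              exact ENNReal.sum_le_tsum S

theorem sum_sum_rpow_le (hK : IsInterpolationKernel K N) {p q : ℝ}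
    (hpq : p.HolderConjugate q) (hp2 : p ≤ 2) {s : α → ℝ≥0} {t : ∀ l, κ l → ℝ≥0}
    (hst : ∀ l m, HasSum (fun a => K l m a * s a) (t l m : ℂ)) (M : ∀ l, Finset (κ l)) :
    ∑ l, (∑ m ∈ M l, (t l m : ℝ≥0∞) ^ p) ^ (q / p) ≤
      N * (∑' a, (s a : ℝ≥0∞) ^ p) ^ (q / p) := by
  have hq := hpq.symm.pos
  choose c hc htc using fun l => (NNReal.isGreatest_Lp (M l) (t l) hpq).1
  obtain ⟨γ, hγ, htγ⟩ := (NNReal.isGreatest_Lp Finset.univ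
    (fun l => (∑ m ∈ M l, t l m ^ p) ^ (1 / p)) hpq.symm).1
  have hdual : ∑ l, ∑ m ∈ M l, γ l * c l m * t l m =
      (∑ l, (∑ m ∈ M l, t l m ^ p) ^ (q / p)) ^ (1 / q) := by
    simp only [← NNReal.rpow_mul, one_div_mul_eq_div] at htγ
    rw [← htγ]
    refine Finset.sum_congr rfl fun l _ => ?_
    rw [← htc, Finset.sum_mul]
    exact Finset.sum_congr rfl fun m _ => by ring
  calc ∑ l, (∑ m ∈ M l, (t l m : ℝ≥0∞) ^ p) ^ (q / p)
      = ((∑ l, ∑ m ∈ M l, γ l * c l m * t l m : ℝ≥0) : ℝ≥0∞) ^ q := by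
        rw [hdual, ← ENNReal.coe_rpow_of_nonneg _ hq.le, ← NNReal.rpow_mul,
          one_div_mul_cancel hq.ne', NNReal.rpow_one]
        simp only [ENNReal.ofNNReal_finsetSum, ENNReal.coe_rpow_of_nonneg, hpq.nonneg,
          div_nonneg hq.le hpq.nonneg]
    _ ≤ (N ^ (1 / q) * (∑' a, (s a : ℝ≥0∞) ^ p) ^ (1 / p)) ^ q := by
        gcongr
        exact hK.sum_mul_le_of_hasSum hpq hp2 hst hγ hc
    _ = N * (∑' a, (s a : ℝ≥0∞) ^ p) ^ (q / p) := by
        rw [ENNReal.mul_rpow_of_nonneg _ _ hq.le, ← ENNReal.rpow_mul, ← ENNReal.rpow_mul,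
          one_div_mul_cancel hq.ne', ENNReal.rpow_one, one_div_mul_eq_div]

theorem sum_tsum_rpow_le (hK : IsInterpolationKernel K N) {p q : ℝ}
    (hpq : p.HolderConjugate q) (hp2 : p ≤ 2) {s : α → ℝ≥0} {t : ∀ l, κ l → ℝ≥0}
    (hst : ∀ l m, HasSum (fun a => K l m a * s a) (t l m : ℂ)) :
    ∑ l, (∑' m, (t l m : ℝ≥0∞) ^ p) ^ (q / p) ≤ N * (∑' a, (s a : ℝ≥0∞) ^ p) ^ (q / p) := by
  have hlim : Filter.Tendsto
      (fun M : ∀ l, Finset (κ l) => ∑ l, (∑ m ∈ M l, (t l m : ℝ≥0∞) ^ p) ^ (q / p))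
      (Filter.pi fun _ => Filter.atTop) (nhds (∑ l, (∑' m, (t l m : ℝ≥0∞) ^ p) ^ (q / p))) :=
    tendsto_finsetSum _ fun l _ => ((ENNReal.continuous_rpow_const.tendsto _).comp
      ENNReal.summable.hasSum).comp (Filter.tendsto_eval_pi _ l)
  exact le_of_tendsto' hlim (hK.sum_sum_rpow_le hpq hp2 hst)

theorem enorm_sum_mul_le (hK : IsInterpolationKernel K N) {p q : ℝ}
    (hpq : p.HolderConjugate q) (hp2 : p ≤ 2) {t : ∀ l, κ l → ℝ≥0} {u : L → α → ℂ}
    (htu : ∀ l a, HasSum (fun m => (t l m : ℂ) * K l m a) (u l a)) (S : Finset α) {d : α → ℝ≥0}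
    (hd : ∑ a ∈ S, d a ^ p ≤ 1) :
    ‖∑ l, ∑ a ∈ S, u l a * d a‖ₑ ≤
      N ^ (1 / q) * (∑ l, (∑' m, (t l m : ℝ≥0∞) ^ q) ^ (p / q)) ^ (1 / p) := by
  have hlim : Filter.Tendsto
      (fun M : ∀ l, Finset (κ l) => ∑ l, ∑ m ∈ M l, ∑ a ∈ S, (t l m : ℂ) * K l m a * d a)
      (Filter.pi fun _ => Filter.atTop) (nhds (∑ l, ∑ a ∈ S, u l a * d a)) := by
    refine tendsto_finsetSum _ fun l _ => ?_
    have hl : Filter.Tendsto (fun M => ∑ m ∈ M, ∑ a ∈ S, (t l m : ℂ) * K l m a * d a)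
        Filter.atTop (nhds (∑ a ∈ S, u l a * d a)) :=
      hasSum_sum fun a _ => (htu l a).mul_right (d a : ℂ)
    exact hl.comp (Filter.tendsto_eval_pi _ l)
  refine le_of_tendsto' hlim.enorm fun M => ?_
  calc ‖∑ l, ∑ m ∈ M l, ∑ a ∈ S, (t l m : ℂ) * K l m a * d a‖ₑ
      ≤ ((N ^ (1 / q) * (∑ l, (∑ m ∈ M l, t l m ^ q) ^ (p / q)) ^ (1 / p) *
          (∑ a ∈ S, d a ^ p) ^ (1 / p) : ℝ≥0) : ℝ≥0∞) := by
        exact_mod_cast hK.nnnorm_sum_le_rpow hpq hp2 M t S d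
    _ ≤ ((N ^ (1 / q) * (∑ l, (∑ m ∈ M l, t l m ^ q) ^ (p / q)) ^ (1 / p) : ℝ≥0) : ℝ≥0∞) := by
        exact ENNReal.coe_le_coe.mpr <| mul_le_of_le_one_right' <|
          NNReal.rpow_le_one hd hpq.one_div_nonneg
    _ = N ^ (1 / q) * (∑ l, (∑ m ∈ M l, (t l m : ℝ≥0∞) ^ q) ^ (p / q)) ^ (1 / p) := by
        simp only [ENNReal.coe_mul, ENNReal.ofNNReal_finsetSum, ENNReal.coe_rpow_of_nonneg,
          hpq.symm.nonneg, hpq.one_div_nonneg, hpq.symm.one_div_nonneg,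
          div_nonneg hpq.nonneg hpq.symm.nonneg]
    _ ≤ N ^ (1 / q) * (∑ l, (∑' m, (t l m : ℝ≥0∞) ^ q) ^ (p / q)) ^ (1 / p) := by
        have := hpq.one_div_nonneg
        have := div_nonneg hpq.nonneg hpq.symm.nonneg
        gcongr with l
        exact ENNReal.sum_le_tsum _

theorem mul_tsum_rpow_le (hK : IsInterpolationKernel K N) {p q : ℝ}
    (hpq : p.HolderConjugate q) (hp2 : p ≤ 2) {s : α → ℝ≥0} {t : ∀ l, κ l → ℝ≥0} {u : L → α → ℂ}
    (htu : ∀ l a, HasSum (fun m => (t l m : ℂ) * K l m a) (u l a))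
    (hus : ∀ a, ∑ l, u l a = N * s a) :
    N * (∑' a, (s a : ℝ≥0∞) ^ q) ^ (p / q) ≤ ∑ l, (∑' m, (t l m : ℝ≥0∞) ^ q) ^ (p / q) := by
  have hp := hpq.pos
  rcases eq_or_ne N 0 with rfl | hN
  · simp
  have hlim := (ENNReal.continuous_rpow_const (y := p / q)).tendsto _ |>.comp
    (ENNReal.summable (f := fun a => (s a : ℝ≥0∞) ^ q)).hasSum
  refine le_of_tendsto' (ENNReal.Tendsto.const_mul hlim (Or.inr ENNReal.coe_ne_top)) fun S => ?_
  obtain ⟨d, hd, hsd⟩ := (NNReal.isGreatest_Lp S s hpq.symm).1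
  have hu : ∑ l, ∑ a ∈ S, u l a * d a = ((N * (∑ a ∈ S, s a ^ q) ^ (1 / q) : ℝ≥0) : ℂ) := by
    rw [Finset.sum_comm, ← hsd]
    push_cast
    simp only [← Finset.sum_mul, hus, Finset.mul_sum, mul_assoc]
  have key := hK.enorm_sum_mul_le hpq hp2 htu S hd
  rw [hu, enorm_eq_nnnorm, Complex.nnnorm_real, NNReal.nnnorm_eq] at key
  have hN' : (N : ℝ≥0∞) ^ (p / q) ≠ 0 := by simp [hN]
  have hN_pow : N ^ p = N ^ (p / q) * N := by
    nth_rw 3 [← NNReal.rpow_one N]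
    rw [← NNReal.rpow_add hN, hpq.div_conj_eq_sub_one, sub_add_cancel]
  refine (ENNReal.mul_le_mul_iff_right hN' (by finiteness)).mp ?_
  calc (N : ℝ≥0∞) ^ (p / q) * (N * (∑ a ∈ S, (s a : ℝ≥0∞) ^ q) ^ (p / q))
      = ((N * (∑ a ∈ S, s a ^ q) ^ (1 / q) : ℝ≥0) : ℝ≥0∞) ^ p := by
        rw [← ENNReal.coe_rpow_of_nonneg _ hp.le, NNReal.mul_rpow, ← NNReal.rpow_mul,
          one_div_mul_eq_div, hN_pow, ENNReal.coe_mul, ENNReal.coe_mul, mul_assoc]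
        simp only [ENNReal.ofNNReal_finsetSum, ENNReal.coe_rpow_of_nonneg, hpq.symm.nonneg,
          div_nonneg hp.le hpq.symm.nonneg]
    _ ≤ (N ^ (1 / q) * (∑ l, (∑' m, (t l m : ℝ≥0∞) ^ q) ^ (p / q)) ^ (1 / p)) ^ p := by gcongr
    _ = N ^ (p / q) * ∑ l, (∑' m, (t l m : ℝ≥0∞) ^ q) ^ (p / q) := by
        rw [ENNReal.mul_rpow_of_nonneg _ _ hp.le, ← ENNReal.rpow_mul, ← ENNReal.rpow_mul,
          one_div_mul_cancel hp.ne', ENNReal.rpow_one, one_div_mul_eq_div]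

end IsInterpolationKernel

end Kernel

theorem hasSum_sigma_of_fintype {R I : Type*} [AddCommMonoid R] [TopologicalSpace R]
    [ContinuousAdd R] [Fintype I] {ι : I → Type*} {F : (Σ i, ι i) → R} {a : I → R}
    (h : ∀ i, HasSum (fun k => F ⟨i, k⟩) (a i)) : HasSum F (∑ i, a i) := by
  have hext : ∀ i, HasSum (Function.extend (Sigma.mk i) (fun k => F ⟨i, k⟩) 0) (a i) := fun i =>
    (hasSum_extend_zero sigma_mk_injective).mpr (h i)
  refine (hasSum_sum fun i _ => hext i).congr_fun ?_
  rintro ⟨j, k⟩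
  rw [Finset.sum_eq_single j, sigma_mk_injective.extend_apply]
  · intro i _ hij
    rw [Function.extend_apply' _ _ _ (by rintro ⟨_, hk⟩; exact hij (congrArg Sigma.fst hk)),
      Pi.zero_apply]
  · simp

section OrthogonalMixing

variable {E : Type*} [NormedAddCommGroup E] [InnerProductSpace ℂ E]

theorem norm_sq_sum_smul_eq_of_inner_eq_ite {β : Type*} [DecidableEq β] {S : Finset β} {v : β → E}
    (hv : ∀ a ∈ S, ∀ b ∈ S, ⟪v a, v b⟫_ℂ = if a = b then 1 else 0) (c : β → ℂ) :
    ‖∑ a ∈ S, c a • v a‖ ^ 2 = ∑ a ∈ S, ‖c a‖ ^ 2 := by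
  have h : ⟪∑ a ∈ S, c a • v a, ∑ a ∈ S, c a • v a⟫_ℂ = ∑ a ∈ S, (‖c a‖ : ℂ) ^ 2 := by
    simp only [sum_inner, inner_sum, inner_smul_left, inner_smul_right]
    refine Finset.sum_congr rfl fun a ha => ?_
    rw [Finset.sum_eq_single_of_mem a ha fun b hb hba => by simp [hv b hb a ha, hba],
      hv a ha a ha, if_pos rfl, mul_one, Complex.mul_conj']
  rw [norm_sq_eq_re_inner (𝕜 := ℂ), h]
  exact_mod_cast Complex.ofReal_re _

variable {L I : Type*} [Fintype L] [DecidableEq I]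

theorem sum_star_mul_eq_ite {T : Matrix L I ℂ} {N : ℝ≥0}
    (hT : T.conjTranspose * T = (N : ℂ) • 1) (i j : I) :
    ∑ l, star (T l i) * T l j = if i = j then (N : ℂ) else 0 := by
  simpa [Matrix.mul_apply, Matrix.one_apply] using congrFun₂ hT i j

theorem sum_norm_sq_sum_smul [Fintype I] {T : Matrix L I ℂ} {N : ℝ≥0}
    (hT : T.conjTranspose * T = (N : ℂ) • 1) (w : I → E) :
    ∑ l, ‖∑ i, T l i • w i‖ ^ 2 = N * ∑ i, ‖w i‖ ^ 2 := by
  have h : ∑ l, ⟪∑ i, T l i • w i, ∑ i, T l i • w i⟫_ℂ = ∑ i, N * ⟪w i, w i⟫_ℂ := by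
    calc ∑ l, ⟪∑ i, T l i • w i, ∑ i, T l i • w i⟫_ℂ
        = ∑ i, ∑ j, (∑ l, star (T l j) * T l i) * ⟪w j, w i⟫_ℂ := by
          simp only [sum_inner, inner_sum, inner_smul_left, inner_smul_right, Finset.sum_mul,
            Finset.mul_sum]
          rw [Finset.sum_comm]
          refine Finset.sum_congr rfl fun i _ => ?_
          rw [Finset.sum_comm]
          exact Finset.sum_congr rfl fun j _ => Finset.sum_congr rfl fun l _ => by
            rw [starRingEnd_apply, mul_assoc, mul_left_comm]
      _ = ∑ i, N * ⟪w i, w i⟫_ℂ := by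
          simp only [sum_star_mul_eq_ite hT, ite_mul, zero_mul, Finset.sum_ite_eq', Finset.mem_univ,
            if_true]
  simpa [norm_sq_eq_re_inner (𝕜 := ℂ), Finset.mul_sum] using congrArg Complex.re h

theorem norm_sum_inner_sq_le (v w : L → E) :
    ‖∑ l, ⟪v l, w l⟫_ℂ‖ ^ 2 ≤ (∑ l, ‖v l‖ ^ 2) * ∑ l, ‖w l‖ ^ 2 := by
  calc ‖∑ l, ⟪v l, w l⟫_ℂ‖ ^ 2 ≤ (∑ l, ‖v l‖ * ‖w l‖) ^ 2 := by
        gcongr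
        exact norm_sum_le_of_le _ fun l _ => norm_inner_le_norm _ _
    _ ≤ (∑ l, ‖v l‖ ^ 2) * ∑ l, ‖w l‖ ^ 2 := Finset.sum_mul_sq_le_sq_mul_sq _ _ _

theorem norm_sq_sum_smul_filter_fst_eq {ι : I → Type*} {U : ∀ i, ι i → E}
    (hU : ∀ i, Orthonormal ℂ (U i)) (s : Finset (Σ i, ι i)) (d : (Σ i, ι i) → ℂ) (i : I) :
    ‖∑ a ∈ s with a.1 = i, d a • U a.1 a.2‖ ^ 2 = ∑ a ∈ s with a.1 = i, ‖d a‖ ^ 2 := by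
  classical
  refine norm_sq_sum_smul_eq_of_inner_eq_ite ?_ d
  rintro ⟨j, a⟩ ha ⟨k, b⟩ hb
  obtain rfl : j = i := (Finset.mem_filter.mp ha).2
  obtain rfl : k = j := (Finset.mem_filter.mp hb).2
  simpa using orthonormal_iff_ite.mp (hU k) a b

theorem sum_smul_sum_filter_fst {R M : Type*} [Semiring R] [AddCommMonoid M] [Module R M]
    [Fintype I] {ι : I → Type*} (r : I → R) (s : Finset (Σ i, ι i))
    (x : (Σ i, ι i) → M) :
    ∑ i, r i • ∑ a ∈ s with a.1 = i, x a = ∑ a ∈ s, r a.1 • x a := by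
  rw [← Finset.sum_fiberwise s Sigma.fst]
  refine Finset.sum_congr rfl fun i _ => ?_
  rw [Finset.smul_sum]
  exact Finset.sum_congr rfl fun a ha => by rw [(Finset.mem_filter.mp ha).2]

theorem norm_sum_mul_inner_sq_le [Finite I] {T : Matrix L I ℂ} {N : ℝ≥0}
    (hT : T.conjTranspose * T = (N : ℂ) • 1) {κ : L → Type*} {ι : I → Type*}
    {V : ∀ l, κ l → E} {U : ∀ i, ι i → E} (hV : ∀ l, Orthonormal ℂ (V l))
    (hU : ∀ i, Orthonormal ℂ (U i)) (M : ∀ l, Finset (κ l)) (s : Finset (Σ i, ι i))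
    (c : ∀ l, κ l → ℂ) (d : (Σ i, ι i) → ℂ) :
    ‖∑ l, ∑ m ∈ M l, ∑ a ∈ s, c l m * (T l a.1 * ⟪V l m, U a.1 a.2⟫_ℂ) * d a‖ ^ 2 ≤
      N * (∑ l, ∑ m ∈ M l, ‖c l m‖ ^ 2) * ∑ a ∈ s, ‖d a‖ ^ 2 := by
  classical
  have := Fintype.ofFinite I
  let v : L → E := fun l => ∑ m ∈ M l, star (c l m) • V l m
  let w : I → E := fun i => ∑ a ∈ s with a.1 = i, d a • U a.1 a.2
  have hv : ∀ l, ‖v l‖ ^ 2 = ∑ m ∈ M l, ‖c l m‖ ^ 2 := fun l => by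
    simpa only [Pi.star_apply, norm_star] using norm_sq_sum_smul_eq_of_inner_eq_ite
      (fun m _ n _ => orthonormal_iff_ite.mp (hV l) m n) (star (c l))
  have hw : ∀ i, ‖w i‖ ^ 2 = ∑ a ∈ s with a.1 = i, ‖d a‖ ^ 2 :=
    norm_sq_sum_smul_filter_fst_eq hU s d
  have hTw : ∀ l, ∑ i, T l i • w i = ∑ a ∈ s, T l a.1 • d a • U a.1 a.2 := fun l =>
    sum_smul_sum_filter_fst (T l) s fun a => d a • U a.1 a.2
  have hform : ∀ l, ⟪v l, ∑ i, T l i • w i⟫_ℂ =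
      ∑ m ∈ M l, ∑ a ∈ s, c l m * (T l a.1 * ⟪V l m, U a.1 a.2⟫_ℂ) * d a := fun l => by
    rw [hTw, sum_inner]
    refine Finset.sum_congr rfl fun m _ => ?_
    rw [inner_smul_left, inner_sum, Finset.mul_sum]
    refine Finset.sum_congr rfl fun a _ => ?_
    rw [inner_smul_right, inner_smul_right, starRingEnd_apply, star_star]
    ring
  calc ‖∑ l, ∑ m ∈ M l, ∑ a ∈ s, c l m * (T l a.1 * ⟪V l m, U a.1 a.2⟫_ℂ) * d a‖ ^ 2
      = ‖∑ l, ⟪v l, ∑ i, T l i • w i⟫_ℂ‖ ^ 2 := by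
        simp only [hform]
    _ ≤ (∑ l, ‖v l‖ ^ 2) * ∑ l, ‖∑ i, T l i • w i‖ ^ 2 := norm_sum_inner_sq_le _ _
    _ = N * (∑ l, ∑ m ∈ M l, ‖c l m‖ ^ 2) * ∑ a ∈ s, ‖d a‖ ^ 2 := by
        rw [sum_norm_sq_sum_smul hT]
        simp only [hv, hw]
        rw [Finset.sum_fiberwise s Sigma.fst]
        ring

end OrthogonalMixing

universe u

variable {H : Type u} [NormedAddCommGroup H] [InnerProductSpace ℂ H]

/-- A singular value decomposition `X = ∑ k, s k • ⟪e k, ·⟫ • f k` of an operator. Singular values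
may vanish, but `e` and `f` need not be complete. -/
structure IsSchmidtDecomp {κ : Type*} (X : H →L[ℂ] H) (s : κ → ℝ≥0) (e f : κ → H) : Prop where
  orthonormal_left : Orthonormal ℂ e
  orthonormal_right : Orthonormal ℂ f
  hasSum : ∀ x, HasSum (fun k => ((s k : ℂ) * ⟪e k, x⟫_ℂ) • f k) (X x)

namespace IsSchmidtDecomp

variable {κ : Type*} {X : H →L[ℂ] H} {s : κ → ℝ≥0} {e f : κ → H}

theorem hasSum_inner (h : IsSchmidtDecomp X s e f) (x y : H) :
    HasSum (fun k => (s k : ℂ) * (⟪y, f k⟫_ℂ * ⟪e k, x⟫_ℂ)) ⟪y, X x⟫_ℂ := by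
  have hsum := (h.hasSum x).mapL (innerSL ℂ y)
  simp only [innerSL_apply_apply, inner_smul_right] at hsum
  exact hsum.congr_fun fun k => by ring

theorem apply_left (h : IsSchmidtDecomp X s e f) (k : κ) : X (e k) = (s k : ℂ) • f k := by
  classical
  refine (h.hasSum (e k)).unique ?_
  convert hasSum_single k fun j hj => ?_
  · simp [inner_self_eq_norm_sq_to_K, h.orthonormal_left.1 k]
  · simp [h.orthonormal_left.2 hj]

theorem inner_right_apply (h : IsSchmidtDecomp X s e f) (k : κ) (x : H) :
    ⟪f k, X x⟫_ℂ = s k * ⟪e k, x⟫_ℂ := by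
  refine (h.hasSum_inner x (f k)).unique ?_
  convert hasSum_single k fun j hj => ?_
  · simp [inner_self_eq_norm_sq_to_K, h.orthonormal_right.1 k]
  · simp [h.orthonormal_right.2 hj.symm]

theorem apply_eq_zero (h : IsSchmidtDecomp X s e f) {x : H} (hx : ∀ k, ⟪e k, x⟫_ℂ = 0) :
    X x = 0 :=
  (h.hasSum x).unique (by simp [hx, hasSum_zero])

end IsSchmidtDecomp

theorem sum_norm_inner_mul_inner_le {κ : Type*} {g h : κ → H} (hg : Orthonormal ℂ g)
    (hh : Orthonormal ℂ h) {x y : H} (hx : ‖x‖ ≤ 1) (hy : ‖y‖ ≤ 1) (M : Finset κ) :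
    ∑ m ∈ M, ‖⟪h m, x⟫_ℂ‖ * ‖⟪y, g m⟫_ℂ‖ ≤ 1 := by
  have hx' : ∑ m ∈ M, ‖⟪h m, x⟫_ℂ‖ ^ 2 ≤ 1 :=
    (hh.sum_inner_products_le x).trans (pow_le_one₀ (norm_nonneg x) hx)
  have hy' : ∑ m ∈ M, ‖⟪g m, y⟫_ℂ‖ ^ 2 ≤ 1 :=
    (hg.sum_inner_products_le y).trans (pow_le_one₀ (norm_nonneg y) hy)
  simp only [norm_inner_symm y]
  refine (sq_le_one_iff₀ (by positivity)).mp ?_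
  exact (Finset.sum_mul_sq_le_sq_mul_sq _ _ _).trans (mul_le_one₀ hx' (by positivity) hy')

theorem orthonormal_tmul_comp {κ : Type*} {g h : κ → H} (hh : Orthonormal ℂ h)
    (hg : Orthonormal ℂ g) {J : H → H} (hJ : ∀ x y, ⟪J x, J y⟫_ℂ = ⟪y, x⟫_ℂ) :
    Orthonormal ℂ fun m => h m ⊗ₜ[ℂ] J (g m) := by
  classical
  rw [orthonormal_iff_ite] at *
  intro m n
  rw [TensorProduct.inner_tmul, hJ, hh, hg]
  split_ifs <;> simp_all

theorem exists_conjugation [CompleteSpace H] :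
    ∃ J : H → H, ∀ x y, ⟪J x, J y⟫_ℂ = ⟪y, x⟫_ℂ := by
  obtain ⟨w, b, -⟩ := exists_hilbertBasis ℂ H
  refine ⟨fun x => b.repr.symm (star (b.repr x)), fun x y => ?_⟩
  rw [b.repr.symm.inner_map_map, ← b.repr.inner_map_map, lp.inner_eq_tsum, lp.inner_eq_tsum]
  refine tsum_congr fun i => ?_
  simp [mul_comm]

section SchmidtKernel

variable {L I : Type*} {κ : L → Type*} {ι : I → Type*}

/-- The array relating the singular values of operators `A i` with singular vectors `e i`, `f i`
to those of `∑ i, T l i • A i` with singular vectors `g l`, `h l`. -/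
noncomputable def schmidtKernel (T : Matrix L I ℂ) (g h : ∀ l, κ l → H) (e f : ∀ i, ι i → H)
    (l : L) (m : κ l) (a : Σ i, ι i) : ℂ :=
  T l a.1 * (⟪h l m, f a.1 a.2⟫_ℂ * ⟪e a.1 a.2, g l m⟫_ℂ)

variable {T : Matrix L I ℂ} {N : ℝ≥0} {A : I → H →L[ℂ] H} {s : ∀ i, ι i → ℝ≥0}
  {t : ∀ l, κ l → ℝ≥0} {g h : ∀ l, κ l → H} {e f : ∀ i, ι i → H}

theorem isInterpolationKernel_schmidtKernel [CompleteSpace H] [Fintype L] [Finite I] [DecidableEq I]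
    (hT : T.conjTranspose * T = (N : ℂ) • 1) (hT1 : ∀ l i, ‖T l i‖ ≤ 1)
    (hg : ∀ l, Orthonormal ℂ (g l)) (hh : ∀ l, Orthonormal ℂ (h l))
    (he : ∀ i, Orthonormal ℂ (e i)) (hf : ∀ i, Orthonormal ℂ (f i)) :
    IsInterpolationKernel (schmidtKernel T g h e f) N where
  sum_nnnorm_le_one l M a := by
    rw [← NNReal.coe_le_coe]
    push_cast
    calc ∑ m ∈ M, ‖schmidtKernel T g h e f l m a‖
        = ‖T l a.1‖ * ∑ m ∈ M, ‖⟪h l m, f a.1 a.2⟫_ℂ‖ * ‖⟪e a.1 a.2, g l m⟫_ℂ‖ := by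
          simp only [schmidtKernel, norm_mul, Finset.mul_sum]
      _ ≤ 1 := mul_le_one₀ (hT1 l a.1) (by positivity) <|
          sum_norm_inner_mul_inner_le (hg l) (hh l) ((hf a.1).1 a.2).le ((he a.1).1 a.2).le M
  nnnorm_sum_sq_le M S c d := by
    -- The conjugation makes `⟪h, f⟫⟪e, g⟫` an inner product in the tensor square of `H`.
    obtain ⟨J, hJ⟩ := exists_conjugation (H := H)
    have hK : ∀ l m a, schmidtKernel T g h e f l m a = T l a.1 *
        ⟪h l m ⊗ₜ[ℂ] J (g l m), f a.1 a.2 ⊗ₜ[ℂ] J (e a.1 a.2)⟫_ℂ := fun l m a => by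
      rw [TensorProduct.inner_tmul, hJ, schmidtKernel]
    simp only [hK]
    rw [← NNReal.coe_le_coe]
    push_cast
    exact norm_sum_mul_inner_sq_le hT (fun l => orthonormal_tmul_comp (hh l) (hg l) hJ)
      (fun i => orthonormal_tmul_comp (hf i) (he i) hJ) M S c d

theorem hasSum_schmidtKernel_mul [Fintype I] (hs : ∀ i, IsSchmidtDecomp (A i) (s i) (e i) (f i))
    {l : L} (ht : IsSchmidtDecomp (∑ i, T l i • A i) (t l) (g l) (h l)) (m : κ l) :
    HasSum (fun a => schmidtKernel T g h e f l m a * s a.1 a.2) (t l m : ℂ) := by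
  have hinner : (t l m : ℂ) = ∑ i, T l i * ⟪h l m, A i (g l m)⟫_ℂ := by
    calc (t l m : ℂ) = ⟪h l m, (∑ i, T l i • A i) (g l m)⟫_ℂ := by
          rw [ht.inner_right_apply, inner_self_eq_norm_sq_to_K, ht.orthonormal_left.1 m]
          simp
      _ = ∑ i, T l i * ⟪h l m, A i (g l m)⟫_ℂ := by
          simp only [sum_apply, smul_apply, inner_sum, inner_smul_right]
  rw [hinner]
  refine hasSum_sigma_of_fintype fun i => ?_
  refine (((hs i).hasSum_inner (g l m) (h l m)).mul_left (T l i)).congr_fun fun k => ?_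
  rw [schmidtKernel]
  ring

theorem hasSum_mul_schmidtKernel {B : H →L[ℂ] H} {l : L}
    (ht : IsSchmidtDecomp B (t l) (g l) (h l)) (a : Σ i, ι i) :
    HasSum (fun m => (t l m : ℂ) * schmidtKernel T g h e f l m a)
      (T l a.1 * star ⟪f a.1 a.2, B (e a.1 a.2)⟫_ℂ) := by
  have hconj := ((ht.hasSum_inner (e a.1 a.2) (f a.1 a.2)).star).mul_left (T l a.1)
  refine hconj.congr_fun fun m => ?_
  simp only [schmidtKernel, ← starRingEnd_apply, map_mul, inner_conj_symm, Complex.conj_ofReal]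
  ring

theorem sum_mul_star_inner_sum_smul [Fintype L] [Fintype I] [DecidableEq I]
    (hT : T.conjTranspose * T = (N : ℂ) • 1)
    (hs : ∀ i, IsSchmidtDecomp (A i) (s i) (e i) (f i)) (a : Σ i, ι i) :
    ∑ l, T l a.1 * star ⟪f a.1 a.2, (∑ i, T l i • A i) (e a.1 a.2)⟫_ℂ = N * s a.1 a.2 := by
  obtain ⟨j, k⟩ := a
  have hsv : ⟪f j k, A j (e j k)⟫_ℂ = s j k := by
    simp [(hs j).inner_right_apply, inner_self_eq_norm_sq_to_K, (hs j).orthonormal_left.1 k]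
  calc ∑ l, T l j * star ⟪f j k, (∑ i, T l i • A i) (e j k)⟫_ℂ
      = ∑ i, (∑ l, star (T l i) * T l j) * star ⟪f j k, A i (e j k)⟫_ℂ := by
        simp only [sum_apply, smul_apply, inner_sum, inner_smul_right, star_sum, star_mul',
          Finset.mul_sum, Finset.sum_mul]
        rw [Finset.sum_comm]
        exact Finset.sum_congr rfl fun i _ => Finset.sum_congr rfl fun l _ => by ring
    _ = N * star ⟪f j k, A j (e j k)⟫_ℂ := by
        simp only [sum_star_mul_eq_ite hT, ite_mul, zero_mul, Finset.sum_ite_eq', Finset.mem_univ,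
          if_true]
    _ = N * s j k := by rw [hsv, ← starRingEnd_apply, Complex.conj_ofReal]

end SchmidtKernel

theorem isCompactOperator_sum_smul {I : Type*} [Fintype I] {A : I → H →L[ℂ] H} (c : I → ℂ)
    (hA : ∀ i, IsCompactOperator (A i)) :
    IsCompactOperator (∑ i, c i • A i : H →L[ℂ] H) :=
  Submodule.sum_mem (compactOperator (RingHom.id ℂ) H H) fun i _ => Submodule.smul_mem _ _ (hA i)

variable [CompleteSpace H]

theorem mem_spectrum_of_apply_eq_smul {T : H →L[ℂ] H} {x : H} (hx : x ≠ 0) {r : ℝ}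
    (h : T x = (r : ℂ) • x) : r ∈ spectrum ℝ T := by
  intro hu
  refine hx ((ContinuousLinearMap.isUnit_iff_bijective.mp hu).1 ?_)
  simp [h, Algebra.algebraMap_eq_smul_one]

theorem cfc_apply_eq_smul_of_apply_eq_smul {T : H →L[ℂ] H} (hT : IsSelfAdjoint T) {x : H} {r : ℝ}
    (h : T x = (r : ℂ) • x) {f : ℝ → ℝ} (hf : ContinuousOn f (spectrum ℝ T)) :
    cfc f T x = (f r : ℂ) • x := by
  rcases eq_or_ne x 0 with rfl | hx
  · simp
  let r' : spectrum ℝ T := ⟨r, mem_spectrum_of_apply_eq_smul hx h⟩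
  let Φ : C(spectrum ℝ T, ℝ) →⋆ₐ[ℝ] (H →L[ℂ] H) := cfcHom (p := IsSelfAdjoint) hT
  suffices key : ∀ g, Φ g x = (g r' : ℂ) • x by
    rw [cfc_apply f T hT hf]
    exact key _
  have hid : Φ (.restrict (spectrum ℝ T) (.id ℝ)) x = (r : ℂ) • x := by rw [cfcHom_id, h]
  intro g
  induction g using ContinuousMap.induction_on_of_compact with
  | const c =>
    have hc : Φ (.const _ c) = algebraMap ℝ _ c := AlgHomClass.commutes Φ c
    simp [hc, Algebra.algebraMap_eq_smul_one]
  | id => exact hid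
  | star_id => rwa [star_trivial]
  | add f g hf hg => simp [hf, hg, add_smul]
  | mul f g hf hg =>
    rw [map_mul, mul_apply_eq_comp, hg, map_smul, hf, smul_smul, mul_comm, ContinuousMap.mul_apply,
      Complex.ofReal_mul]
  | frequently g hg =>
    have hΦ : Continuous Φ := cfcHom_continuous hT
    have hclosed : IsClosed {g | Φ g x = (g r' : ℂ) • x} :=
      isClosed_eq (by fun_prop) (by fun_prop)
    exact hclosed.mem_of_frequently_of_tendsto hg Filter.tendsto_id

theorem exists_hilbertBasis_eigenvectors {T : H →L[ℂ] H} (hsym : T.IsSymmetric)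
    (hc : IsCompactOperator T) :
    ∃ (ι : Type u) (b : HilbertBasis ι ℂ H), ∀ i, ∃ μ : ℂ, T (b i) = μ • b i := by
  let V : ℂ → Submodule ℂ H := Module.End.eigenspace (T : Module.End ℂ H)
  choose w b _ using fun μ => exists_hilbertBasis ℂ (V μ)
  have hv : Orthonormal ℂ fun a : Σ μ, w μ => (b a.1 a.2 : H) :=
    hsym.orthogonalFamily_eigenspaces.orthonormal_sigma_orthonormal fun μ => (b μ).orthonormal
  have hbot : (Submodule.span ℂ (Set.range fun a : Σ μ, w μ => (b a.1 a.2 : H)))ᗮ = ⊥ := by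
    rw [eq_bot_iff, ← ContinuousLinearMap.orthogonalComplement_iSup_eigenspaces_eq_bot hc hsym,
      ← Submodule.iInf_orthogonal]
    refine le_iInf fun μ x hx => (Submodule.mem_orthogonal' _ _).mpr fun y hy => ?_
    have hsum := (((b μ).hasSum_repr ⟨y, hy⟩).mapL (V μ).subtypeL).mapL (innerSL ℂ x)
    have hz : ∀ i : w μ, ⟪x, (b μ i : H)⟫_ℂ = 0 := fun i =>
      (Submodule.mem_orthogonal' _ _).mp hx _ (Submodule.subset_span ⟨⟨μ, i⟩, rfl⟩)
    refine hsum.unique ?_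
    simp [hz, hasSum_zero]
  refine ⟨_, HilbertBasis.mkOfOrthogonalEqBot hv hbot, fun a => ⟨a.1, ?_⟩⟩
  rw [HilbertBasis.coe_mkOfOrthogonalEqBot]
  exact Module.End.mem_eigenspace_iff.mp (b a.1 a.2).2

theorem eigenvalue_star_mul_self {X : H →L[ℂ] H} {x : H} (hx : ‖x‖ = 1) {μ : ℂ}
    (h : (star X * X) x = μ • x) : μ = ((‖X x‖ ^ 2 : ℝ) : ℂ) := by
  calc μ = ⟪x, (star X * X) x⟫_ℂ := by simp [h, inner_self_eq_norm_sq_to_K, hx]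
    _ = ⟪X x, X x⟫_ℂ := by
      rw [mul_apply_eq_comp, ContinuousLinearMap.star_eq_adjoint,
        ContinuousLinearMap.adjoint_inner_right]
    _ = ((‖X x‖ ^ 2 : ℝ) : ℂ) := by simp [inner_self_eq_norm_sq_to_K]

theorem posTrace_abs_rpow_eq_tsum {X : H →L[ℂ] H} {ι : Type*} (b : HilbertBasis ι ℂ H)
    (hb : ∀ i, ∃ μ : ℂ, (star X * X) (b i) = μ • b i) {p : ℝ} (hp : 0 < p) :
    posTrace (CFC.abs X ^ p) = ∑' i, ‖X (b i)‖ₑ ^ p := by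
  have h0 : 0 ≤ star X * X := star_mul_self_nonneg X
  have hcfc : CFC.abs X ^ p = cfc (fun x : ℝ => x ^ (p / 2)) (star X * X) := by
    rw [CFC.abs, CFC.sqrt_eq_rpow, CFC.rpow_rpow_of_exponent_nonneg _ _ _ (by norm_num) hp.le,
      CFC.rpow_eq_cfc_real, one_div_mul_eq_div]
  rw [posTrace_eq_diagSum b _ CFC.rpow_nonneg]
  refine tsum_congr fun i => ?_
  obtain ⟨μ, hμ⟩ := hb i
  rw [eigenvalue_star_mul_self (b.orthonormal.1 i) hμ] at hμ
  rw [hcfc, cfc_apply_eq_smul_of_apply_eq_smul h0.isSelfAdjoint hμ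
      (Real.continuous_rpow_const (by positivity)).continuousOn, inner_smul_right,
    inner_self_eq_norm_sq_to_K, b.orthonormal.1 i, ← Real.rpow_natCast, ← Real.rpow_mul (by simp),
    ← ofReal_norm, ENNReal.ofReal_rpow_of_nonneg (norm_nonneg _) hp.le]
  simp [mul_div_cancel₀]

namespace IsSchmidtDecomp

variable {κ : Type*} {X : H →L[ℂ] H} {s : κ → ℝ≥0} {e f : κ → H}

theorem star_apply_right (h : IsSchmidtDecomp X s e f) (k : κ) :
    (star X) (f k) = (s k : ℂ) • e k := by
  refine ext_inner_right ℂ fun x => ?_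
  rw [ContinuousLinearMap.star_eq_adjoint, ContinuousLinearMap.adjoint_inner_left,
    h.inner_right_apply, inner_smul_left, Complex.conj_ofReal]

theorem posTrace_abs_rpow (h : IsSchmidtDecomp X s e f) {p : ℝ} (hp : 0 < p) :
    posTrace (CFC.abs X ^ p) = ∑' k, (s k : ℝ≥0∞) ^ p := by
  obtain ⟨w, b, hew, hb⟩ := h.orthonormal_left.toSubtypeRange.exists_hilbertBasis_extension
  let j : κ → w := fun k => ⟨e k, hew ⟨k, rfl⟩⟩
  have hbj : ∀ k, b (j k) = e k := fun k => congrFun hb (j k)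
  have hj : Function.Injective j := fun k l hkl =>
    h.orthonormal_left.linearIndependent.injective (congrArg Subtype.val hkl)
  have hker : ∀ i ∉ Set.range j, X (b i) = 0 := fun i hi =>
    h.apply_eq_zero fun k => hbj k ▸ b.orthonormal.2 fun hk => hi ⟨k, hk⟩
  have heig : ∀ i, ∃ μ : ℂ, (star X * X) (b i) = μ • b i := by
    intro i
    by_cases hi : i ∈ Set.range j
    · obtain ⟨k, rfl⟩ := hi
      exact ⟨s k * s k, by
        rw [hbj, mul_apply_eq_comp, h.apply_left, map_smul, h.star_apply_right, smul_smul]⟩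
    · exact ⟨0, by rw [mul_apply_eq_comp, hker i hi, map_zero, zero_smul]⟩
  have hnorm : ∀ k, ‖X (b (j k))‖ₑ = s k := fun k => by
    rw [hbj, h.apply_left, enorm_smul, ← ofReal_norm (f k), h.orthonormal_right.1 k]
    simp [enorm_eq_nnnorm]
  rw [posTrace_abs_rpow_eq_tsum b heig hp, ← hj.tsum_eq]
  · exact tsum_congr fun k => by rw [hnorm]
  · intro i hi
    by_contra hij
    exact hi (by simp [hker i hij, hp])

theorem schattenNorm_rpow (h : IsSchmidtDecomp X s e f) {p : ℝ} (hp : 0 < p) (r : ℝ) :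
    schattenNorm p X ^ r = (∑' k, (s k : ℝ≥0∞) ^ p) ^ (r / p) := by
  rw [schattenNorm, h.posTrace_abs_rpow hp, ← ENNReal.rpow_mul, one_div_mul_eq_div]

end IsSchmidtDecomp

theorem exists_isSchmidtDecomp {X : H →L[ℂ] H} (hX : IsCompactOperator X) :
    ∃ (κ : Type u) (s : κ → ℝ≥0) (e f : κ → H), IsSchmidtDecomp X s e f := by
  obtain ⟨ι, b, hb⟩ := exists_hilbertBasis_eigenvectors
    (IsSelfAdjoint.star_mul_self X).isSymmetric (hX.clm_comp (star X))
  have hinner : ∀ i j, ⟪X (b i), X (b j)⟫_ℂ = ((‖X (b j)‖ ^ 2 : ℝ) : ℂ) * ⟪b i, b j⟫_ℂ := by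
    intro i j
    obtain ⟨μ, hμ⟩ := hb j
    rw [← eigenvalue_star_mul_self (b.orthonormal.1 j) hμ, ← inner_smul_right, ← hμ,
      mul_apply_eq_comp, ContinuousLinearMap.star_eq_adjoint,
      ContinuousLinearMap.adjoint_inner_right]
  refine ⟨{i // X (b i) ≠ 0}, fun k => ‖X (b k)‖₊, fun k => b k,
    fun k => ((‖X (b k)‖⁻¹ : ℝ) : ℂ) • X (b k), b.orthonormal.comp _ Subtype.val_injective,
    ⟨fun k => ?_, fun k l hkl => ?_⟩, fun x => ?_⟩
  · have := norm_ne_zero_iff.mpr k.2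
    rw [norm_smul, Complex.norm_real, norm_inv, norm_norm, inv_mul_cancel₀ this]
  · simp only [inner_smul_left, inner_smul_right, hinner,
      b.orthonormal.2 (Subtype.val_injective.ne hkl), mul_zero]
  · have hsum : HasSum (fun i => ⟪b i, x⟫_ℂ • X (b i)) (X x) := by
      simpa [b.repr_apply_apply] using (b.hasSum_repr x).mapL X
    have hsupp : Function.support (fun i => ⟪b i, x⟫_ℂ • X (b i)) ⊆ {i | X (b i) ≠ 0} :=
      Function.support_smul_subset_right _ _
    refine ((hasSum_subtype_iff_of_support_subset hsupp).mpr hsum).congr_fun fun k => ?_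
    have hk : (‖X (b k)‖ : ℂ) ≠ 0 := by exact_mod_cast norm_ne_zero_iff.mpr k.2
    rw [smul_smul, coe_nnnorm, Complex.ofReal_inv, mul_right_comm, mul_inv_cancel₀ hk, one_mul,
      Function.comp_apply]

section MatrixInequality

variable {L I : Type*} [Fintype I] {A : I → H →L[ℂ] H} {p q : ℝ}

theorem sum_schattenNorm_rpow_eq_tsum {ι : I → Type*} {s : ∀ i, ι i → ℝ≥0} {e f : ∀ i, ι i → H}
    (hs : ∀ i, IsSchmidtDecomp (A i) (s i) (e i) (f i)) (hp : 0 < p) :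
    ∑ i, schattenNorm p (A i) ^ p = ∑' a : Σ i, ι i, (s a.1 a.2 : ℝ≥0∞) ^ p := by
  rw [ENNReal.tsum_sigma fun i k => (s i k : ℝ≥0∞) ^ p, tsum_fintype]
  exact Finset.sum_congr rfl fun i _ => by
    rw [(hs i).schattenNorm_rpow hp, div_self hp.ne', ENNReal.rpow_one]

variable [Fintype L] [DecidableEq I] {T : Matrix L I ℂ} {N : ℝ≥0}

theorem sum_schattenNorm_rpow_le (hT : T.conjTranspose * T = (N : ℂ) • 1)
    (hT1 : ∀ l i, ‖T l i‖ ≤ 1) (hA : ∀ i, IsCompactOperator (A i)) (hpq : p.HolderConjugate q)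
    (hp2 : p ≤ 2) :
    ∑ l, schattenNorm p (∑ i, T l i • A i) ^ q ≤ N * (∑ i, schattenNorm p (A i) ^ p) ^ (q / p) := by
  choose ι s e f hs using fun i => exists_isSchmidtDecomp (hA i)
  choose κ t g h ht using fun l => exists_isSchmidtDecomp (isCompactOperator_sum_smul (T l) hA)
  have hK : IsInterpolationKernel (schmidtKernel T g h e f) N :=
    isInterpolationKernel_schmidtKernel hT hT1 (fun l => (ht l).orthonormal_left)
      (fun l => (ht l).orthonormal_right) (fun i => (hs i).orthonormal_left)
      (fun i => (hs i).orthonormal_right)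
  simp only [sum_schattenNorm_rpow_eq_tsum hs hpq.pos, (ht _).schattenNorm_rpow hpq.pos]
  exact hK.sum_tsum_rpow_le hpq hp2 fun l => hasSum_schmidtKernel_mul hs (ht l)

theorem le_sum_schattenNorm_rpow (hT : T.conjTranspose * T = (N : ℂ) • 1)
    (hT1 : ∀ l i, ‖T l i‖ ≤ 1) (hA : ∀ i, IsCompactOperator (A i)) (hpq : p.HolderConjugate q)
    (hp2 : 2 ≤ p) :
    N * (∑ i, schattenNorm p (A i) ^ p) ^ (q / p) ≤ ∑ l, schattenNorm p (∑ i, T l i • A i) ^ q := by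
  choose ι s e f hs using fun i => exists_isSchmidtDecomp (hA i)
  choose κ t g h ht using fun l => exists_isSchmidtDecomp (isCompactOperator_sum_smul (T l) hA)
  have hK : IsInterpolationKernel (schmidtKernel T g h e f) N :=
    isInterpolationKernel_schmidtKernel hT hT1 (fun l => (ht l).orthonormal_left)
      (fun l => (ht l).orthonormal_right) (fun i => (hs i).orthonormal_left)
      (fun i => (hs i).orthonormal_right)
  have hq2 : q ≤ 2 := (le_two_iff_of_holderConjugate hpq.symm).mpr hp2
  simp only [sum_schattenNorm_rpow_eq_tsum hs hpq.pos, (ht _).schattenNorm_rpow hpq.pos]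
  exact hK.mul_tsum_rpow_le hpq.symm hq2 (fun l => hasSum_mul_schmidtKernel (ht l))
    (sum_mul_star_inner_sum_smul hT hs)

end MatrixInequality

section SumDifference

variable {I : Type*} [Fintype I] [LinearOrder I]

/-- The matrix of the map that sends a family `A` to its sum, at the row `none`, and its differences
`A i - A j` for `i < j`. -/
def sumDiffMatrix (I : Type*) [LinearOrder I] :
    Matrix (Option {ij : I × I // ij.1 < ij.2}) I ℂ
  | none => 1
  | some ij => Pi.single ij.1.1 1 - Pi.single ij.1.2 1

theorem norm_sumDiffMatrix_le_one {I : Type*} [LinearOrder I]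
    (l : Option {ij : I × I // ij.1 < ij.2}) (i : I) : ‖sumDiffMatrix I l i‖ ≤ 1 := by
  rcases l with _ | l
  · simp [sumDiffMatrix]
  · simp only [sumDiffMatrix, Pi.sub_apply, Pi.single_apply]
    split_ifs <;> norm_num

theorem two_nsmul_sum_lt_eq_sum {R : Type*} [AddCommMonoid R] (φ : I × I → R)
    (hsymm : ∀ x, φ x.swap = φ x) (hdiag : ∀ a, φ (a, a) = 0) :
    2 • ∑ x with x.1 < x.2, φ x = ∑ x, φ x := by
  let ψ : I × I → R := fun x => if x.1 < x.2 then φ x else 0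
  have hsplit : ∀ x, φ x = ψ x + ψ x.swap := by
    rintro ⟨a, b⟩
    rcases lt_trichotomy a b with h | rfl | h
    · simp [ψ, h, h.not_gt]
    · simp [ψ, hdiag]
    · simpa [ψ, h, h.not_gt] using (hsymm (a, b)).symm
  have hswap : ∑ x : I × I, ψ x.swap = ∑ x, ψ x := (Equiv.prodComm I I).sum_comp ψ
  calc 2 • ∑ x with x.1 < x.2, φ x = ∑ x, ψ x + ∑ x : I × I, ψ x.swap := by
        rw [hswap, ← two_nsmul, Finset.sum_filter]
    _ = ∑ x, φ x := by simp only [← Finset.sum_add_distrib, ← hsplit]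

theorem sum_sub_mul_sub {I R : Type*} [Fintype I] [CommRing R] (f g : I → R) :
    ∑ x : I × I, (f x.1 - f x.2) * (g x.1 - g x.2) =
      2 * (Fintype.card I * ∑ a, f a * g a - (∑ a, f a) * ∑ a, g a) := by
  calc ∑ x : I × I, (f x.1 - f x.2) * (g x.1 - g x.2)
      = ∑ a, ∑ b, (f a * g a + f b * g b - f a * g b - f b * g a) := by
        rw [Fintype.sum_prod_type]
        exact Finset.sum_congr rfl fun a _ => Finset.sum_congr rfl fun b _ => by ring
    _ = 2 * (Fintype.card I * ∑ a, f a * g a - (∑ a, f a) * ∑ a, g a) := by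
        simp only [Finset.sum_sub_distrib, Finset.sum_add_distrib, Finset.sum_const,
          Finset.card_univ, nsmul_eq_mul, ← Finset.mul_sum, ← Finset.sum_mul]
        ring

theorem sum_lt_sub_mul_sub {R : Type*} [CommRing R] [IsAddTorsionFree R] (f g : I → R) :
    ∑ x : I × I with x.1 < x.2, (f x.1 - f x.2) * (g x.1 - g x.2) =
      Fintype.card I * ∑ a, f a * g a - (∑ a, f a) * ∑ a, g a := by
  refine nsmul_right_injective two_ne_zero ?_
  simp only
  rw [two_nsmul_sum_lt_eq_sum (fun x : I × I => (f x.1 - f x.2) * (g x.1 - g x.2))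
      (fun x => by simp only [Prod.fst_swap, Prod.snd_swap]; ring) (fun a => by simp),
    sum_sub_mul_sub, nsmul_eq_mul, Nat.cast_two]

theorem conjTranspose_sumDiffMatrix_mul_self :
    (sumDiffMatrix I).conjTranspose * sumDiffMatrix I = ((Fintype.card I : ℝ≥0) : ℂ) • 1 := by
  ext i j
  let δ : I → I → ℂ := fun k a => if k = a then 1 else 0
  calc ((sumDiffMatrix I).conjTranspose * sumDiffMatrix I) i j
      = 1 + ∑ x : I × I with x.1 < x.2, (δ i x.1 - δ i x.2) * (δ j x.1 - δ j x.2) := by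
        rw [Matrix.mul_apply, Fintype.sum_option, ← Finset.sum_subtype_eq_sum_filter,
          Finset.subtype_univ]
        simp [sumDiffMatrix, δ, Pi.single_apply, apply_ite (starRingEnd ℂ)]
    _ = 1 + (Fintype.card I * ∑ a, δ i a * δ j a - (∑ a, δ i a) * ∑ a, δ j a) := by
        rw [sum_lt_sub_mul_sub]
    _ = (((Fintype.card I : ℝ≥0) : ℂ) • (1 : Matrix I I ℂ)) i j := by
        simp [δ, Matrix.one_apply]

theorem sum_option_sumDiffMatrix_smul {E R : Type*} [AddCommGroup E] [Module ℂ E]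
    [AddCommMonoid R] (A : I → E) (F : E → R) :
    ∑ l, F (∑ i, sumDiffMatrix I l i • A i) =
      F (∑ i, A i) + ∑ ij : I × I with ij.1 < ij.2, F (A ij.1 - A ij.2) := by
  rw [Fintype.sum_option, ← Finset.sum_subtype_eq_sum_filter, Finset.subtype_univ]
  simp [sumDiffMatrix, Pi.single_apply, sub_smul]

end SumDifference

theorem theorem1p4_general {I : Type*} [Fintype I] [LinearOrder I] {p q : ℝ}
    (hpq : p.HolderConjugate q) (A : I → H →L[ℂ] H) (hA : ∀ i, IsCompactOperator (A i)) :
    (p ≤ 2 →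
      schattenNorm p (∑ i, A i) ^ q
          + ∑ ij : I × I with ij.1 < ij.2, schattenNorm p (A ij.1 - A ij.2) ^ q
        ≤ (Fintype.card I : ℝ≥0∞) * (∑ i, schattenNorm p (A i) ^ p) ^ (q / p)) ∧
    (2 ≤ p →
      (Fintype.card I : ℝ≥0∞) * (∑ i, schattenNorm p (A i) ^ p) ^ (q / p)
        ≤ schattenNorm p (∑ i, A i) ^ q
          + ∑ ij : I × I with ij.1 < ij.2, schattenNorm p (A ij.1 - A ij.2) ^ q) := by
  rw [← sum_option_sumDiffMatrix_smul A fun X => schattenNorm p X ^ q,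
    ← ENNReal.coe_natCast (Fintype.card I)]
  exact ⟨sum_schattenNorm_rpow_le conjTranspose_sumDiffMatrix_mul_self norm_sumDiffMatrix_le_one
      hA hpq,
    le_sum_schattenNorm_rpow conjTranspose_sumDiffMatrix_mul_self norm_sumDiffMatrix_le_one
      hA hpq⟩

theorem theorem1p4 {H : Type*} [NormedAddCommGroup H] [InnerProductSpace ℂ H] [CompleteSpace H]
    [TopologicalSpace.SeparableSpace H] (n : ℕ) (p q : ℝ) (hp : 0 < p) (hq : 0 < q)
    (hpq : 1 / p + 1 / q = 1) (A : Fin n → H →L[ℂ] H) (hA : ∀ i, A i ∈ schattenClass H p) :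
    (1 < p → p ≤ 2 →
      schattenNorm p (∑ i, A i) ^ q
          + ∑ ij : Fin n × Fin n with ij.1 < ij.2, schattenNorm p (A ij.1 - A ij.2) ^ q
        ≤ (n : ℝ≥0∞) * (∑ i, schattenNorm p (A i) ^ p) ^ (q / p)) ∧
    (2 ≤ p →
      (n : ℝ≥0∞) * (∑ i, schattenNorm p (A i) ^ p) ^ (q / p)
        ≤ schattenNorm p (∑ i, A i) ^ q
          + ∑ ij : Fin n × Fin n with ij.1 < ij.2, schattenNorm p (A ij.1 - A ij.2) ^ q) := by
  have hconj : p.HolderConjugate q := ⟨by simpa using hpq, hp, hq⟩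
  have h := theorem1p4_general hconj A fun i => (hA i).1
  rw [Fintype.card_fin] at h
  exact ⟨fun _ => h.1, h.2⟩
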